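/- Let $H_1,H_2,H_3$ be complex Hilbert spaces, and for Hilbert spaces $H,K$ let $\mathcal B(H,K)$ denote the bounded linear operators from $H$ to $K$, with $\mathcal B(H)=\mathcal B(H,H)$. A contraction is a bounded linear operator of operator norm at most $1$; for a contraction $T\in\mathcal B(H)$ let $D_T=(I-T^*T)^{1/2}$ (positive square root) be its defect operator. Let $W_i\in\mathcal B(H_i)$, $i=1,2,3$, be contractions with $\|W_2\|<1$, let $A_1\in\mathcal B(H_2,H_1)$, $A_2\in\mathcal B(H_3,H_2)$, $B\in\mathcal B(H_3,H_1)$, and put $$T=\begin{bmatrix} W_1 & A_1 & B\\ 0 & W_2 & A_2\\ 0&0&W_3\end{bmatrix}\in\mathcal B(H_1\oplus H_2\oplus H_3),$$ where $H_1\oplus H_2\oplus H_3$ is the Hilbert space direct sum. Then $T$ is a contraction if and only if there exist contractions $V_1\in\mathcal B(H_2,H_1)$, $V_2\in\mathcal B(H_3,H_2)$, $V_3\in\mathcal B(H_3,H_1)$ such that $$A_1=D_{W_1^*}V_1D_{W_2},\qquad A_2=D_{W_2^*}V_2D_{W_3},$$ $$B=\left[D_{W_1^*}(I-V_1V_1^*)D_{W_1^*}\right]^{1/2}V_3\left[D_{W_3}(I-V_2^*V_2)D_{W_3}\right]^{1/2}-D_{W_1^*}V_1W_2^*V_2D_{W_3}.$$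 -/

import Mathlib

noncomputable section

/-- The Hilbert space direct sum `H₁ ⊕ H₂ ⊕ H₃`, with `‖(x, y, z)‖² = ‖x‖² + ‖y‖² + ‖z‖²`. -/
abbrev HilbertSum3 (H₁ H₂ H₃ : Type*) : Type _ := WithLp 2 (H₁ × WithLp 2 (H₂ × H₃))

/-- The defect operator `D_T = (I - T* T)^{1/2}` of a Hilbert space contraction. -/
def defectOp {H : Type*} [NormedAddCommGroup H] [InnerProductSpace ℂ H] [CompleteSpace H]
    (T : H →L[ℂ] H) : H →L[ℂ] H :=
  CFC.sqrt (1 - ContinuousLinearMap.adjoint T ∘L T)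

section
variable (H₁ H₂ H₃ : Type*)
  [NormedAddCommGroup H₁] [InnerProductSpace ℂ H₁]
  [NormedAddCommGroup H₂] [InnerProductSpace ℂ H₂]
  [NormedAddCommGroup H₃] [InnerProductSpace ℂ H₃]

/-- The coordinate projection of `H₁ ⊕ H₂ ⊕ H₃` onto `H₁`. -/
def HilbertSum3.proj₁ : HilbertSum3 H₁ H₂ H₃ →L[ℂ] H₁ := WithLp.fstL 2 ℂ H₁ (WithLp 2 (H₂ × H₃))

/-- The coordinate projection of `H₁ ⊕ H₂ ⊕ H₃` onto `H₂`. -/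
def HilbertSum3.proj₂ : HilbertSum3 H₁ H₂ H₃ →L[ℂ] H₂ :=
  WithLp.fstL 2 ℂ H₂ H₃ ∘L WithLp.sndL 2 ℂ H₁ (WithLp 2 (H₂ × H₃))

/-- The coordinate projection of `H₁ ⊕ H₂ ⊕ H₃` onto `H₃`. -/
def HilbertSum3.proj₃ : HilbertSum3 H₁ H₂ H₃ →L[ℂ] H₃ :=
  WithLp.sndL 2 ℂ H₂ H₃ ∘L WithLp.sndL 2 ℂ H₁ (WithLp 2 (H₂ × H₃))

variable {H₁ H₂ H₃}

/-- The bounded operator on `H₁ ⊕ H₂ ⊕ H₃` with the upper triangular operator matrix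
`[[W₁, A₁, B], [0, W₂, A₂], [0, 0, W₃]]`. -/
def upperTriangularOp (W₁ : H₁ →L[ℂ] H₁) (W₂ : H₂ →L[ℂ] H₂) (W₃ : H₃ →L[ℂ] H₃)
    (A₁ : H₂ →L[ℂ] H₁) (A₂ : H₃ →L[ℂ] H₂) (B : H₃ →L[ℂ] H₁) :
    HilbertSum3 H₁ H₂ H₃ →L[ℂ] HilbertSum3 H₁ H₂ H₃ :=
  (WithLp.prodContinuousLinearEquiv 2 ℂ H₁ (WithLp 2 (H₂ × H₃))).symm.toContinuousLinearMap ∘L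
    (W₁ ∘L HilbertSum3.proj₁ H₁ H₂ H₃ + A₁ ∘L HilbertSum3.proj₂ H₁ H₂ H₃ + B ∘L HilbertSum3.proj₃ H₁ H₂ H₃).prod
      ((WithLp.prodContinuousLinearEquiv 2 ℂ H₂ H₃).symm.toContinuousLinearMap ∘L
        (W₂ ∘L HilbertSum3.proj₂ H₁ H₂ H₃ + A₂ ∘L HilbertSum3.proj₃ H₁ H₂ H₃).prod (W₃ ∘L HilbertSum3.proj₃ H₁ H₂ H₃))

theorem upperTriangularOp_apply (W₁ : H₁ →L[ℂ] H₁) (W₂ : H₂ →L[ℂ] H₂) (W₃ : H₃ →L[ℂ] H₃)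
    (A₁ : H₂ →L[ℂ] H₁) (A₂ : H₃ →L[ℂ] H₂) (B : H₃ →L[ℂ] H₁) (x : H₁) (y : H₂) (z : H₃) :
    upperTriangularOp W₁ W₂ W₃ A₁ A₂ B (WithLp.toLp 2 (x, WithLp.toLp 2 (y, z))) =
      WithLp.toLp 2 (W₁ x + A₁ y + B z, WithLp.toLp 2 (W₂ y + A₂ z, W₃ z)) :=
  rfl

end

end

/-!
Write `D_T` for `defectOp T`. As `‖W₂‖ < 1`, the operators `D_{W₂}` and `D_{W₂*}` are invertible, so
`A₁ = C₁ D_{W₂}` and `A₂ = D_{W₂*} C₂` for unique `C₁`, `C₂`. The Julia operator of `W₂` is isometric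
(`julia_norm_sq`), that is, with `u = D_{W₂} y - W₂* C₂ z`,
`‖y‖² - ‖W₂ y + A₂ z‖² = ‖u‖² - ‖C₂ z‖²`. Since `u` ranges over all of `H₂` as `y` does, the operator
matrix is a contraction iff, with `Y = B + C₁ W₂* C₂`,
`‖W₁ x + C₁ u + Y z‖² ≤ ‖x‖² + ‖u‖² + (‖z‖² - ‖W₃ z‖² - ‖C₂ z‖²)` for all `x`, `u`, `z`
(`norm_upperTriangularOp_le_one_iff`).

The rest is Douglas' factorization lemma (`exists_contraction_comp_eq`). The inequality with
`x = u = 0` gives `‖C₂ z‖ ≤ ‖D_{W₃} z‖`, hence `C₂ = V₂ D_{W₃}`. With `z = 0` it says that the row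
`[W₁ C₁]` is a contraction; for the adjoint column this reads `‖C₁* h‖ ≤ ‖D_{W₁*} h‖`, hence
`C₁ = D_{W₁*} V₁`. Finally the bracket on the right is `‖E z‖²` with
`E = [D_{W₃} (1 - V₂* V₂) D_{W₃}]^{1/2}`, so `[W₁ C₁ Y] = [W₁ C₁ Z] diag(1, 1, E)` with a row
contraction `[W₁ C₁ Z]`, and passing to adjoints again gives `Z = F V₃` with
`F = [D_{W₁*} (1 - V₁ V₁*) D_{W₁*}]^{1/2}` (`forall_norm_row_sq_le_iff`). These steps are reversible.
-/

open ContinuousLinearMap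

/-! ### Douglas factorization -/

section Factorization

variable {E F G : Type*}
  [NormedAddCommGroup E] [InnerProductSpace ℂ E]
  [NormedAddCommGroup F] [InnerProductSpace ℂ F] [CompleteSpace F]
  [NormedAddCommGroup G] [InnerProductSpace ℂ G] [CompleteSpace G]

/-- Douglas' factorization: if `‖R x‖ ≤ ‖S x‖` for all `x`, then `R` factors through `S` by a
contraction. The contraction extends `S x ↦ R x` by continuity to the closure of the range of `S`,
and is zero on the orthogonal complement. -/
theorem exists_contraction_comp_eq (R : E →L[ℂ] F) (S : E →L[ℂ] G) (h : ∀ x, ‖R x‖ ≤ ‖S x‖) :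
    ∃ C : G →L[ℂ] F, ‖C‖ ≤ 1 ∧ R = C ∘L S := by
  set M := S.range.topologicalClosure
  have hM (x : E) : S x ∈ M := S.range.le_topologicalClosure ⟨x, rfl⟩
  let e : E →ₗ[ℂ] M := S.toLinearMap.codRestrict M hM
  have he : DenseRange e := by
    intro y
    rw [closure_subtype, ← Set.range_comp]
    exact y.2
  have hR (x : E) : ‖R.toLinearMap x‖ ≤ 1 * ‖e x‖ := by simpa [e] using h x
  have : CompleteSpace M := S.range.isClosed_topologicalClosure.completeSpace_coe
  refine ⟨R.toLinearMap.extendOfNorm e ∘L M.orthogonalProjectionOnto, ?_, ?_⟩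
  · refine (opNorm_comp_le _ _).trans (mul_le_one₀ ?_ (norm_nonneg _) ?_)
    · exact LinearMap.opNorm_extendOfNorm_le he zero_le_one hR
    · exact M.orthogonalProjectionOnto_norm_le
  · ext x
    have : M.orthogonalProjectionOnto (S x) = e x :=
      M.orthogonalProjectionOnto_mem_subspace_eq_self ⟨S x, hM x⟩
    rw [coe_comp, Function.comp_apply, coe_comp, Function.comp_apply, this,
      LinearMap.extendOfNorm_eq he ⟨1, hR⟩]
    rfl

/-- The dual form of Douglas' factorization, where the contraction is the right-hand factor. -/
theorem exists_contraction_eq_comp [CompleteSpace E] {R : F →L[ℂ] E} {S : E →L[ℂ] E}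
    (hS : IsSelfAdjoint S) (h : ∀ x, ‖adjoint R x‖ ≤ ‖S x‖) :
    ∃ C : F →L[ℂ] E, ‖C‖ ≤ 1 ∧ R = S ∘L C := by
  obtain ⟨C, hC, hRC⟩ := exists_contraction_comp_eq (adjoint R) S h
  refine ⟨adjoint C, by rwa [LinearIsometryEquiv.norm_map], ?_⟩
  rw [← adjoint_adjoint R, hRC, adjoint_comp, hS.adjoint_eq]

end Factorization

/-! ### Defect operators -/

section DefectOp

variable {H K : Type*}
  [NormedAddCommGroup H] [InnerProductSpace ℂ H] [CompleteSpace H]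
  [NormedAddCommGroup K] [InnerProductSpace ℂ K] [CompleteSpace K]

theorem isSelfAdjoint_cfc_sqrt (P : H →L[ℂ] H) : IsSelfAdjoint (CFC.sqrt P) :=
  (CFC.sqrt_nonneg P).isSelfAdjoint

theorem norm_cfc_sqrt_apply_sq {P : H →L[ℂ] H} (hP : 0 ≤ P) (x : H) :
    ‖CFC.sqrt P x‖ ^ 2 = (inner ℂ (P x) x).re := by
  have h : CFC.sqrt P (CFC.sqrt P x) = P x :=
    congrArg (fun Q : H →L[ℂ] H => Q x) (CFC.sqrt_mul_sqrt_self P hP)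
  rw [← h, ← adjoint_inner_right, (isSelfAdjoint_cfc_sqrt P).adjoint_eq]
  exact (inner_self_eq_norm_sq (𝕜 := ℂ) _).symm

theorem re_inner_one_sub_adjoint_comp_self (T : H →L[ℂ] K) (x : H) :
    (inner ℂ ((1 - adjoint T ∘L T) x) x).re = ‖x‖ ^ 2 - ‖T x‖ ^ 2 := by
  simp only [sub_apply, comp_apply, inner_sub_left, adjoint_inner_left, Complex.sub_re]
  congr 1
  · exact inner_self_eq_norm_sq (𝕜 := ℂ) _
  · exact inner_self_eq_norm_sq (𝕜 := ℂ) _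

theorem one_sub_adjoint_comp_self_nonneg {T : H →L[ℂ] K} (hT : ‖T‖ ≤ 1) :
    0 ≤ 1 - adjoint T ∘L T := by
  rw [nonneg_iff_isPositive, isPositive_def']
  refine ⟨?_, fun x => ?_⟩
  · exact (IsSelfAdjoint.one _).sub (isPositive_adjoint_comp_self T).isSelfAdjoint
  · rw [reApplyInnerSelf_apply]
    change 0 ≤ (inner ℂ ((1 - adjoint T ∘L T) x) x).re
    rw [re_inner_one_sub_adjoint_comp_self, sub_nonneg]
    gcongr
    simpa using T.le_of_opNorm_le hT x

theorem isSelfAdjoint_defectOp (T : H →L[ℂ] H) : IsSelfAdjoint (defectOp T) :=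
  isSelfAdjoint_cfc_sqrt _

theorem norm_defectOp_apply_sq {T : H →L[ℂ] H} (hT : ‖T‖ ≤ 1) (x : H) :
    ‖defectOp T x‖ ^ 2 = ‖x‖ ^ 2 - ‖T x‖ ^ 2 := by
  rw [defectOp, norm_cfc_sqrt_apply_sq (one_sub_adjoint_comp_self_nonneg hT),
    re_inner_one_sub_adjoint_comp_self]

theorem norm_sqrt_conj_one_sub_apply_sq {D : H →L[ℂ] H} (hD : IsSelfAdjoint D) {V : H →L[ℂ] K}
    (hV : ‖V‖ ≤ 1) (x : H) :
    ‖CFC.sqrt (D ∘L (1 - adjoint V ∘L V) ∘L D) x‖ ^ 2 = ‖D x‖ ^ 2 - ‖V (D x)‖ ^ 2 := by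
  have hpos : 0 ≤ D ∘L (1 - adjoint V ∘L V) ∘L D := by
    have := ((nonneg_iff_isPositive _).1 (one_sub_adjoint_comp_self_nonneg hV)).conj_adjoint D
    rw [hD.adjoint_eq] at this
    exact (nonneg_iff_isPositive _).2 this
  rw [norm_cfc_sqrt_apply_sq hpos, comp_apply, ← adjoint_inner_right, hD.adjoint_eq, comp_apply,
    re_inner_one_sub_adjoint_comp_self]

/-- The Sylvester equation `a x + x b = 0` with `a, b ≥ 0` and `a` invertible has only the zero
solution: `x* a x = -x* x b` is self-adjoint, so `x* x` and `b` commute, which makes `x* a x` both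
nonnegative and nonpositive. -/
theorem eq_zero_of_mul_eq_neg_mul {A : Type*} [CStarAlgebra A] [PartialOrder A] [StarOrderedRing A]
    {a b x : A} (ha : 0 ≤ a) (hu : IsUnit a) (hb : 0 ≤ b) (h : a * x = -(x * b)) : x = 0 := by
  have h₁ : star x * a * x = -(star x * x * b) := by
    rw [mul_assoc, h, mul_neg, mul_assoc]
  have h₂ : 0 ≤ star x * a * x := star_left_conjugate_nonneg ha x
  have hc : Commute (star x * x) b := by
    rw [commute_iff_eq]
    have := h₂.isSelfAdjoint.star_eq
    rw [h₁, star_neg, neg_inj, star_mul, hb.isSelfAdjoint.star_eq, star_mul, star_star] at this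
    exact this.symm
  have h₃ : star x * a * x = 0 := by
    refine le_antisymm ?_ h₂
    rw [h₁, neg_nonpos]
    exact hc.mul_nonneg (star_mul_self_nonneg x) hb
  have h₄ : CFC.sqrt a * x = 0 := by
    rw [← CStarRing.star_mul_self_eq_zero_iff, star_mul,
      (CFC.sqrt_nonneg a).isSelfAdjoint.star_eq, mul_assoc, ← mul_assoc (CFC.sqrt a),
      CFC.sqrt_mul_sqrt_self a ha, ← mul_assoc, h₃]
  exact ((CFC.isUnit_sqrt_iff a ha).2 hu).mul_right_eq_zero.1 h₄

theorem isUnit_defectOp {T : H →L[ℂ] H} (hT : ‖T‖ < 1) : IsUnit (defectOp T) := by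
  rw [defectOp, CFC.isUnit_sqrt_iff _ (one_sub_adjoint_comp_self_nonneg hT.le)]
  refine isUnit_one_sub_of_norm_lt_one ?_
  rw [norm_adjoint_comp_self]
  exact mul_lt_one_of_nonneg_of_lt_one_left (norm_nonneg _) hT hT.le

theorem defectOp_mul_self {T : H →L[ℂ] H} (hT : ‖T‖ ≤ 1) :
    defectOp T * defectOp T = 1 - adjoint T * T :=
  CFC.sqrt_mul_sqrt_self _ (one_sub_adjoint_comp_self_nonneg hT)

/-- The intertwining relation `D_T T* = T* D_{T*}`. The difference `X` of the two sides satisfies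
`D_T X + X D_{T*} = 0`, because `D_T² T* = T* D_{T*}²`. -/
theorem defectOp_mul_adjoint {T : H →L[ℂ] H} (hT : ‖T‖ < 1) :
    defectOp T * adjoint T = adjoint T * defectOp (adjoint T) := by
  have hT' : ‖adjoint T‖ ≤ 1 := by rw [LinearIsometryEquiv.norm_map]; exact hT.le
  rw [← sub_eq_zero]
  refine eq_zero_of_mul_eq_neg_mul (CFC.sqrt_nonneg _) (isUnit_defectOp hT)
    (CFC.sqrt_nonneg (1 - adjoint (adjoint T) ∘L adjoint T)) ?_
  change defectOp T * _ = -(_ * defectOp (adjoint T))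
  rw [mul_sub, sub_mul, ← mul_assoc, defectOp_mul_self hT.le, mul_assoc (adjoint T),
    defectOp_mul_self hT', adjoint_adjoint]
  noncomm_ring

theorem defectOp_adjoint_mul {T : H →L[ℂ] H} (hT : ‖T‖ < 1) :
    defectOp (adjoint T) * T = T * defectOp T := by
  have := defectOp_mul_adjoint (T := adjoint T) (by rwa [LinearIsometryEquiv.norm_map])
  rwa [adjoint_adjoint] at this

/-- The Julia operator `[[T, D_{T*}], [D_T, -T*]]` is isometric. -/
theorem julia_norm_sq {T : H →L[ℂ] H} (hT : ‖T‖ < 1) (y q : H) :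
    ‖T y + defectOp (adjoint T) q‖ ^ 2 + ‖defectOp T y - adjoint T q‖ ^ 2 =
      ‖y‖ ^ 2 + ‖q‖ ^ 2 := by
  have hT' : ‖adjoint T‖ ≤ 1 := by rw [LinearIsometryEquiv.norm_map]; exact hT.le
  have h₁ := norm_defectOp_apply_sq hT.le y
  have h₂ := norm_defectOp_apply_sq hT' q
  have h₃ : inner ℂ (T y) (defectOp (adjoint T) q) = inner ℂ (defectOp T y) (adjoint T q) := by
    rw [← adjoint_inner_left, (isSelfAdjoint_defectOp _).adjoint_eq, adjoint_inner_right]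
    exact congrArg (fun S : H →L[ℂ] H => inner ℂ (S y) q) (defectOp_adjoint_mul hT)
  rw [norm_add_sq (𝕜 := ℂ), norm_sub_sq (𝕜 := ℂ), h₁, h₂, h₃]
  ring

end DefectOp

/-! ### Row contractions -/

section Row

variable {H₁ H₂ H₃ K : Type*}
  [NormedAddCommGroup H₁] [InnerProductSpace ℂ H₁]
  [NormedAddCommGroup H₂] [InnerProductSpace ℂ H₂]
  [NormedAddCommGroup H₃] [InnerProductSpace ℂ H₃]
  [NormedAddCommGroup K] [InnerProductSpace ℂ K]

theorem norm_le_one_iff_norm_sq_le (T : H₁ →L[ℂ] K) : ‖T‖ ≤ 1 ↔ ∀ v, ‖T v‖ ^ 2 ≤ ‖v‖ ^ 2 := by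
  rw [opNorm_le_iff zero_le_one]
  simp only [one_mul, sq_le_sq₀ (norm_nonneg _) (norm_nonneg _)]

theorem HilbertSum3.norm_sq_toLp {E F G : Type*} [NormedAddCommGroup E] [NormedAddCommGroup F]
    [NormedAddCommGroup G] (x : E) (y : F) (z : G) :
    ‖(WithLp.toLp 2 (x, WithLp.toLp 2 (y, z)) : HilbertSum3 E F G)‖ ^ 2 =
      ‖x‖ ^ 2 + ‖y‖ ^ 2 + ‖z‖ ^ 2 := by
  rw [WithLp.prod_norm_sq_eq_of_L2, WithLp.prod_norm_sq_eq_of_L2, add_assoc]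
  rfl

/-- The row operator `[R₁ R₂ R₃]` from `H₁ ⊕ H₂ ⊕ H₃` to `K`. -/
def rowOp (R₁ : H₁ →L[ℂ] K) (R₂ : H₂ →L[ℂ] K) (R₃ : H₃ →L[ℂ] K) :
    HilbertSum3 H₁ H₂ H₃ →L[ℂ] K :=
  R₁ ∘L HilbertSum3.proj₁ H₁ H₂ H₃ + R₂ ∘L HilbertSum3.proj₂ H₁ H₂ H₃ +
    R₃ ∘L HilbertSum3.proj₃ H₁ H₂ H₃

theorem rowOp_apply (R₁ : H₁ →L[ℂ] K) (R₂ : H₂ →L[ℂ] K) (R₃ : H₃ →L[ℂ] K)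
    (x : H₁) (y : H₂) (z : H₃) :
    rowOp R₁ R₂ R₃ (WithLp.toLp 2 (x, WithLp.toLp 2 (y, z))) = R₁ x + R₂ y + R₃ z :=
  rfl

theorem norm_rowOp_le_one_iff_forall (R₁ : H₁ →L[ℂ] K) (R₂ : H₂ →L[ℂ] K) (R₃ : H₃ →L[ℂ] K) :
    ‖rowOp R₁ R₂ R₃‖ ≤ 1 ↔
      ∀ x y z, ‖R₁ x + R₂ y + R₃ z‖ ^ 2 ≤ ‖x‖ ^ 2 + ‖y‖ ^ 2 + ‖z‖ ^ 2 := by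
  simp only [norm_le_one_iff_norm_sq_le, ← HilbertSum3.norm_sq_toLp, ← rowOp_apply]
  exact ⟨fun h _ _ _ => h _, fun h _ => h _ _ _⟩

variable [CompleteSpace H₁] [CompleteSpace H₂] [CompleteSpace H₃] [CompleteSpace K]

theorem adjoint_rowOp_apply (R₁ : H₁ →L[ℂ] K) (R₂ : H₂ →L[ℂ] K) (R₃ : H₃ →L[ℂ] K) (h : K) :
    adjoint (rowOp R₁ R₂ R₃) h =
      WithLp.toLp 2 (adjoint R₁ h, WithLp.toLp 2 (adjoint R₂ h, adjoint R₃ h)) := by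
  refine ext_inner_right ℂ fun v => ?_
  obtain ⟨x, y, z, rfl⟩ : ∃ x y z, v = WithLp.toLp 2 (x, WithLp.toLp 2 (y, z)) :=
    ⟨_, _, _, rfl⟩
  rw [adjoint_inner_left, rowOp_apply]
  simp [inner_add_right, adjoint_inner_left, add_assoc]

theorem norm_rowOp_le_one_iff_adjoint (R₁ : H₁ →L[ℂ] K) (R₂ : H₂ →L[ℂ] K) (R₃ : H₃ →L[ℂ] K) :
    ‖rowOp R₁ R₂ R₃‖ ≤ 1 ↔
      ∀ h, ‖adjoint R₁ h‖ ^ 2 + ‖adjoint R₂ h‖ ^ 2 + ‖adjoint R₃ h‖ ^ 2 ≤ ‖h‖ ^ 2 := by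
  rw [← LinearIsometryEquiv.norm_map (adjoint : (HilbertSum3 H₁ H₂ H₃ →L[ℂ] K) ≃ₗᵢ⋆[ℂ] _),
    norm_le_one_iff_norm_sq_le]
  simp only [adjoint_rowOp_apply, HilbertSum3.norm_sq_toLp]

/-- If `F` has the modulus of the defect of the row `[W C]`, then the third entry `Y` completes
the row to one dominated by `diag(1, 1, E)` exactly when `Y` factors through `F` and `E` by a
contraction. -/
theorem forall_norm_row_sq_le_iff {W : H₁ →L[ℂ] K} {C : H₂ →L[ℂ] K} {Y : H₃ →L[ℂ] K}
    {F : K →L[ℂ] K} {E : H₃ →L[ℂ] H₃} (hF : IsSelfAdjoint F)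
    (hFn : ∀ h, ‖F h‖ ^ 2 = ‖h‖ ^ 2 - ‖adjoint W h‖ ^ 2 - ‖adjoint C h‖ ^ 2) :
    (∀ x u z, ‖W x + C u + Y z‖ ^ 2 ≤ ‖x‖ ^ 2 + ‖u‖ ^ 2 + ‖E z‖ ^ 2) ↔
      ∃ V : H₃ →L[ℂ] K, ‖V‖ ≤ 1 ∧ Y = F ∘L V ∘L E := by
  constructor
  · intro h
    -- Dividing the whole row by `diag(1, 1, E)` leaves `W` and `C` unchanged, so that the quotient
    -- is a row contraction `[W C Z]` with `Y = Z E`.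
    obtain ⟨Q, hQ, hRQ⟩ := exists_contraction_comp_eq (rowOp W C Y)
      (upperTriangularOp (1 : H₁ →L[ℂ] H₁) (1 : H₂ →L[ℂ] H₂) E 0 0 0) (fun v => by
        obtain ⟨x, u, z, rfl⟩ : ∃ x u z, v = WithLp.toLp 2 (x, WithLp.toLp 2 (u, z)) :=
          ⟨_, _, _, rfl⟩
        rw [← sq_le_sq₀ (norm_nonneg _) (norm_nonneg _), rowOp_apply, upperTriangularOp_apply,
          HilbertSum3.norm_sq_toLp]
        simpa using h x u z)
    have hQ_apply (x : H₁) (u : H₂) (z : H₃) :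
        W x + C u + Y z = Q (WithLp.toLp 2 (x, WithLp.toLp 2 (u, E z))) := by
      rw [← rowOp_apply, hRQ, comp_apply, upperTriangularOp_apply]
      simp
    obtain ⟨Z, hZ⟩ : ∃ Z : H₃ →L[ℂ] K,
        ∀ z, Z z = Q (WithLp.toLp 2 (0, WithLp.toLp 2 (0, z))) :=
      ⟨Q ∘L adjoint (HilbertSum3.proj₃ H₁ H₂ H₃), fun z => by
        have : HilbertSum3.proj₃ H₁ H₂ H₃ = rowOp 0 0 1 := by
          ext v
          simp [rowOp]
        rw [comp_apply, this, adjoint_rowOp_apply, (IsSelfAdjoint.one (H₃ →L[ℂ] H₃)).adjoint_eq]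
        simp⟩
    have hrow : rowOp W C Z = Q := by
      ext v
      obtain ⟨x, u, z, rfl⟩ : ∃ x u z, v = WithLp.toLp 2 (x, WithLp.toLp 2 (u, z)) :=
        ⟨_, _, _, rfl⟩
      have h₁ := hQ_apply x u 0
      rw [map_zero, map_zero, add_zero] at h₁
      rw [rowOp_apply, h₁, hZ, ← map_add]
      simp [← WithLp.toLp_add]
    have hZF : ∀ h, ‖adjoint Z h‖ ≤ ‖F h‖ := by
      intro h
      have := (norm_rowOp_le_one_iff_adjoint W C Z).1 (hrow ▸ hQ) h
      rw [← sq_le_sq₀ (norm_nonneg _) (norm_nonneg _), hFn]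
      linarith
    obtain ⟨V, hV, hZV⟩ := exists_contraction_eq_comp hF hZF
    refine ⟨V, hV, ?_⟩
    ext z
    have h₂ := hQ_apply 0 0 z
    rw [map_zero, map_zero, zero_add, zero_add, ← hZ, hZV] at h₂
    exact h₂
  · rintro ⟨V, hV, rfl⟩ x u z
    have hrow : ‖rowOp W C (F ∘L V)‖ ≤ 1 := by
      refine (norm_rowOp_le_one_iff_adjoint _ _ _).2 fun h => ?_
      rw [adjoint_comp, hF.adjoint_eq, comp_apply]
      have hV' : ‖adjoint V‖ ≤ 1 := by rwa [LinearIsometryEquiv.norm_map]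
      have := (norm_le_one_iff_norm_sq_le _).1 hV' (F h)
      linarith [hFn h]
    exact (norm_rowOp_le_one_iff_forall _ _ _).1 hrow x u (E z)

end Row

/-! ### Upper triangular contractions -/

section UpperTriangular

variable {H₁ H₂ H₃ : Type*}
  [NormedAddCommGroup H₁] [InnerProductSpace ℂ H₁]
  [NormedAddCommGroup H₂] [InnerProductSpace ℂ H₂] [CompleteSpace H₂]
  [NormedAddCommGroup H₃] [InnerProductSpace ℂ H₃]

/-- Since `D_{W₂}` is onto, the second coordinate `y` may be replaced by
`u = D_{W₂} y - W₂* C₂ z`. As the Julia operator of `W₂` is isometric, this removes the second row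
of the operator matrix. -/
theorem norm_upperTriangularOp_le_one_iff {W₁ : H₁ →L[ℂ] H₁} {W₂ : H₂ →L[ℂ] H₂} {W₃ : H₃ →L[ℂ] H₃}
    (hW₂ : ‖W₂‖ < 1) (C₁ : H₂ →L[ℂ] H₁) (C₂ : H₃ →L[ℂ] H₂) (B : H₃ →L[ℂ] H₁) :
    ‖upperTriangularOp W₁ W₂ W₃ (C₁ ∘L defectOp W₂) (defectOp (adjoint W₂) ∘L C₂) B‖ ≤ 1 ↔
      ∀ x u z, ‖W₁ x + C₁ u + (B + C₁ ∘L adjoint W₂ ∘L C₂) z‖ ^ 2 ≤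
        ‖x‖ ^ 2 + ‖u‖ ^ 2 + (‖z‖ ^ 2 - ‖W₃ z‖ ^ 2 - ‖C₂ z‖ ^ 2) := by
  have key (x : H₁) (y : H₂) (z : H₃) :
      ‖upperTriangularOp W₁ W₂ W₃ (C₁ ∘L defectOp W₂) (defectOp (adjoint W₂) ∘L C₂) B
          (WithLp.toLp 2 (x, WithLp.toLp 2 (y, z)))‖ ^ 2 ≤
        ‖(WithLp.toLp 2 (x, WithLp.toLp 2 (y, z)) : HilbertSum3 H₁ H₂ H₃)‖ ^ 2 ↔
      ‖W₁ x + C₁ (defectOp W₂ y - adjoint W₂ (C₂ z)) + (B + C₁ ∘L adjoint W₂ ∘L C₂) z‖ ^ 2 ≤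
        ‖x‖ ^ 2 + ‖defectOp W₂ y - adjoint W₂ (C₂ z)‖ ^ 2 +
          (‖z‖ ^ 2 - ‖W₃ z‖ ^ 2 - ‖C₂ z‖ ^ 2) := by
    have hJ := julia_norm_sq hW₂ y (C₂ z)
    have hrow : W₁ x + C₁ (defectOp W₂ y - adjoint W₂ (C₂ z)) +
        (B + C₁ ∘L adjoint W₂ ∘L C₂) z = W₁ x + C₁ (defectOp W₂ y) + B z := by
      simp only [map_sub, add_apply, comp_apply]
      abel
    rw [upperTriangularOp_apply, HilbertSum3.norm_sq_toLp, HilbertSum3.norm_sq_toLp, hrow,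
      comp_apply, comp_apply]
    constructor <;> intro h <;> linarith
  rw [norm_le_one_iff_norm_sq_le]
  constructor
  · intro h x u z
    obtain ⟨y, hy⟩ : ∃ y, defectOp W₂ y = u + adjoint W₂ (C₂ z) :=
      (isUnit_iff_bijective.1 (isUnit_defectOp hW₂)).2 _
    have := (key x y z).1 (h _)
    rwa [hy, add_sub_cancel_right] at this
  · intro h v
    obtain ⟨x, y, z, rfl⟩ : ∃ x y z, v = WithLp.toLp 2 (x, WithLp.toLp 2 (y, z)) :=
      ⟨_, _, _, rfl⟩
    exact (key x y z).2 (h _ _ _)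

variable [CompleteSpace H₁] [CompleteSpace H₃]

/-- For `A₁` and `A₂` of the required form, `B` completes the operator matrix to a contraction
exactly when it is given by the formula with some contraction `V₃`. -/
theorem norm_upperTriangularOp_defectOp_le_one_iff {W₁ : H₁ →L[ℂ] H₁} {W₂ : H₂ →L[ℂ] H₂}
    {W₃ : H₃ →L[ℂ] H₃} (hW₁ : ‖W₁‖ ≤ 1) (hW₂ : ‖W₂‖ < 1) (hW₃ : ‖W₃‖ ≤ 1) {V₁ : H₂ →L[ℂ] H₁}
    {V₂ : H₃ →L[ℂ] H₂} (hV₁ : ‖V₁‖ ≤ 1) (hV₂ : ‖V₂‖ ≤ 1) (B : H₃ →L[ℂ] H₁) :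
    ‖upperTriangularOp W₁ W₂ W₃ (defectOp (adjoint W₁) ∘L V₁ ∘L defectOp W₂)
        (defectOp (adjoint W₂) ∘L V₂ ∘L defectOp W₃) B‖ ≤ 1 ↔
      ∃ V₃ : H₃ →L[ℂ] H₁, ‖V₃‖ ≤ 1 ∧
        B = CFC.sqrt (defectOp (adjoint W₁) ∘L (1 - V₁ ∘L adjoint V₁) ∘L defectOp (adjoint W₁)) ∘L
            V₃ ∘L CFC.sqrt (defectOp W₃ ∘L (1 - adjoint V₂ ∘L V₂) ∘L defectOp W₃)
          - defectOp (adjoint W₁) ∘L V₁ ∘L adjoint W₂ ∘L V₂ ∘L defectOp W₃ := by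
  have hW₁' : ‖adjoint W₁‖ ≤ 1 := by rwa [LinearIsometryEquiv.norm_map]
  have hV₁' : ‖adjoint V₁‖ ≤ 1 := by rwa [LinearIsometryEquiv.norm_map]
  have hF (h : H₁) :
      ‖CFC.sqrt (defectOp (adjoint W₁) ∘L (1 - V₁ ∘L adjoint V₁) ∘L defectOp (adjoint W₁)) h‖ ^ 2 =
        ‖h‖ ^ 2 - ‖adjoint W₁ h‖ ^ 2 - ‖adjoint (defectOp (adjoint W₁) ∘L V₁) h‖ ^ 2 := by
    have := norm_sqrt_conj_one_sub_apply_sq (isSelfAdjoint_defectOp (adjoint W₁)) hV₁' h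
    rw [adjoint_adjoint, norm_defectOp_apply_sq hW₁'] at this
    rw [this, adjoint_comp, (isSelfAdjoint_defectOp _).adjoint_eq, comp_apply]
  have hE (z : H₃) : ‖z‖ ^ 2 - ‖W₃ z‖ ^ 2 - ‖(V₂ ∘L defectOp W₃) z‖ ^ 2 =
      ‖CFC.sqrt (defectOp W₃ ∘L (1 - adjoint V₂ ∘L V₂) ∘L defectOp W₃) z‖ ^ 2 := by
    rw [norm_sqrt_conj_one_sub_apply_sq (isSelfAdjoint_defectOp W₃) hV₂,
      norm_defectOp_apply_sq hW₃, comp_apply]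
  have key := norm_upperTriangularOp_le_one_iff (W₁ := W₁) (W₃ := W₃) hW₂
    (defectOp (adjoint W₁) ∘L V₁) (V₂ ∘L defectOp W₃) B
  simp only [hE] at key
  rw [forall_norm_row_sq_le_iff (isSelfAdjoint_cfc_sqrt _) hF] at key
  simp only [eq_sub_iff_add_eq]
  exact key

end UpperTriangular

theorem mainTheorem1 {H₁ H₂ H₃ : Type*}
    [NormedAddCommGroup H₁] [InnerProductSpace ℂ H₁] [CompleteSpace H₁]
    [NormedAddCommGroup H₂] [InnerProductSpace ℂ H₂] [CompleteSpace H₂]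
    [NormedAddCommGroup H₃] [InnerProductSpace ℂ H₃] [CompleteSpace H₃]
    (W₁ : H₁ →L[ℂ] H₁) (W₂ : H₂ →L[ℂ] H₂) (W₃ : H₃ →L[ℂ] H₃)
    (A₁ : H₂ →L[ℂ] H₁) (A₂ : H₃ →L[ℂ] H₂) (B : H₃ →L[ℂ] H₁)
    (hW₁ : ‖W₁‖ ≤ 1) (hW₂ : ‖W₂‖ < 1) (hW₃ : ‖W₃‖ ≤ 1) :
    ‖upperTriangularOp W₁ W₂ W₃ A₁ A₂ B‖ ≤ 1 ↔
      ∃ (V₁ : H₂ →L[ℂ] H₁) (V₂ : H₃ →L[ℂ] H₂) (V₃ : H₃ →L[ℂ] H₁),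
        ‖V₁‖ ≤ 1 ∧ ‖V₂‖ ≤ 1 ∧ ‖V₃‖ ≤ 1 ∧
        A₁ = defectOp (ContinuousLinearMap.adjoint W₁) ∘L V₁ ∘L defectOp W₂ ∧
        A₂ = defectOp (ContinuousLinearMap.adjoint W₂) ∘L V₂ ∘L defectOp W₃ ∧
        B = CFC.sqrt (defectOp (ContinuousLinearMap.adjoint W₁) ∘L
                (1 - V₁ ∘L ContinuousLinearMap.adjoint V₁) ∘L
                defectOp (ContinuousLinearMap.adjoint W₁)) ∘L V₃ ∘L
              CFC.sqrt (defectOp W₃ ∘L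
                (1 - ContinuousLinearMap.adjoint V₂ ∘L V₂) ∘L defectOp W₃)
            - defectOp (ContinuousLinearMap.adjoint W₁) ∘L V₁ ∘L
                ContinuousLinearMap.adjoint W₂ ∘L V₂ ∘L defectOp W₃ := by
  constructor
  · intro hT
    obtain ⟨C₁, rfl⟩ : ∃ C₁ : H₂ →L[ℂ] H₁, A₁ = C₁ ∘L defectOp W₂ := by
      obtain ⟨D, hD⟩ := (isUnit_defectOp hW₂).exists_left_inv
      exact ⟨A₁ ∘L D, by rw [comp_assoc]; exact (congrArg (A₁ ∘L ·) hD).symm⟩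
    obtain ⟨C₂, rfl⟩ : ∃ C₂ : H₃ →L[ℂ] H₂,
        A₂ = defectOp (ContinuousLinearMap.adjoint W₂) ∘L C₂ := by
      have hW₂' : ‖adjoint W₂‖ < 1 := by rwa [LinearIsometryEquiv.norm_map]
      obtain ⟨D, hD⟩ := (isUnit_defectOp hW₂').exists_right_inv
      exact ⟨D ∘L A₂, by rw [← comp_assoc]; exact (congrArg (· ∘L A₂) hD).symm⟩
    have hrow := (norm_upperTriangularOp_le_one_iff hW₂ C₁ C₂ B).1 hT
    obtain ⟨V₁, hV₁, rfl⟩ := exists_contraction_eq_comp (R := C₁)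
      (isSelfAdjoint_defectOp (adjoint W₁)) fun h => by
        have hWC : ‖rowOp W₁ C₁ (0 : H₃ →L[ℂ] H₁)‖ ≤ 1 := by
          refine (norm_rowOp_le_one_iff_forall _ _ _).2 fun x u z => ?_
          have := hrow x u 0
          simp only [map_zero, norm_zero] at this
          rw [zero_apply]
          linarith [sq_nonneg ‖z‖]
        have := (norm_rowOp_le_one_iff_adjoint _ _ _).1 hWC h
        rw [← sq_le_sq₀ (norm_nonneg _) (norm_nonneg _),
          norm_defectOp_apply_sq (by rwa [LinearIsometryEquiv.norm_map])]
        linarith [sq_nonneg ‖adjoint (0 : H₃ →L[ℂ] H₁) h‖]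
    obtain ⟨V₂, hV₂, rfl⟩ := exists_contraction_comp_eq C₂ (defectOp W₃) fun z => by
      have := (sq_nonneg _).trans (hrow 0 0 z)
      simp only [norm_zero] at this
      rw [← sq_le_sq₀ (norm_nonneg _) (norm_nonneg _), norm_defectOp_apply_sq hW₃]
      linarith
    obtain ⟨V₃, hV₃, hB⟩ :=
      (norm_upperTriangularOp_defectOp_le_one_iff hW₁ hW₂ hW₃ hV₁ hV₂ B).1 hT
    exact ⟨V₁, V₂, V₃, hV₁, hV₂, hV₃, rfl, rfl, hB⟩
  · rintro ⟨V₁, V₂, V₃, hV₁, hV₂, hV₃, rfl, rfl, hB⟩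
    exact (norm_upperTriangularOp_defectOp_le_one_iff hW₁ hW₂ hW₃ hV₁ hV₂ B).2 ⟨V₃, hV₃, hB⟩
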